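/- Let $\mathbb{K}$ be a field of characteristic zero and let $H_{CK}$ be the Connes–Kreimer Hopf algebra over $\mathbb{K}$: its basis is the set of finite rooted forests (up to isomorphism, non-planar, including the empty forest $1$), its product is disjoint union, and its coproduct is the algebra morphism sending a rooted tree $t$ to $\sum_c l_c\otimes u_c$, where $c$ runs over all the admissible cuts of $t$ (including the empty and the total cut), $l_c$ being the lower part (containing the root, or empty for the total cut) and $u_c$ the upper part. Let $S$ be its antipode. For rooted forests $F$ and $G$, put $F\bullet G=\sum_{v} F\bullet_v G$, where $v$ runs over the vertices of $F$ and $F\bullet_v G$ is obtained from the disjoint union of $F$ and $G$ by adding an edge from $v$ to each root of $G$; extend $\bullet$ bilinearly to $H_{CK}$. Let $\delta_1$ be the one-vertex tree and $\delta_n=\delta_{n-1}\bullet\delta_1$ for $n\geq 2$. Then there are coefficients $a_{i_1,\ldots,i_n}\in\mathbb{K}$ such that for all $n\geq 1$, $$S(\delta_n)=\sum_{\substack{(i_1,\ldots,i_n)\in\mathbb{N}^n,\\ 1i_1+\cdots+ni_n=n}} a_{i_1,\ldots,i_n}\,\delta_1^{i_1}\cdots\delta_n^{i_n}.$$ Moreover,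 any such coefficients satisfy the following, for all $n\geq 1$ and all $(i_1,\ldots,i_n)\in\mathbb{N}^n$ with $1i_1+\cdots+ni_n=n$. If $i_n=1$, then $i_1=\cdots=i_{n-1}=0$ and $a_{i_1,\ldots,i_n}=-1$. Otherwise, $i_n=0$ and $$a_{i_1,\ldots,i_n}=\sum_{\substack{2\leq j\leq n-1,\\ i_j\geq 1}}(i_{j-1}+1)\,a_{i_1,\ldots,i_{j-1}+1,\,i_j-1,\ldots,i_{n-1}}-(n-1)\,\epsilon\, a_{i_1-1,i_2,\ldots,i_{n-1}},$$ where $\epsilon=1$ if $i_1\geq 1$, and $\epsilon=0$ (the last term being absent) if $i_1=0$. -/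

import Mathlib

open scoped TensorProduct

/-! ## Rooted trees and rooted forests -/

/-- Finite multisets form a quotient of a polynomial functor: a multiset of elements of `α` is
represented by its cardinality `n` and a family `Fin n → α`. -/
noncomputable instance Multiset.instQPF : QPF Multiset.{0} where
  P := ⟨ℕ, Fin⟩
  abs p := (List.ofFn p.2 : Multiset _)
  repr s := ⟨s.toList.length, s.toList.get⟩
  abs_repr s := by
    rw [List.ofFn_get, Multiset.coe_toList]
  abs_map f p := by
    obtain ⟨n, g⟩ := p
    simp [PFunctor.map, List.map_ofFn]

/-- Finite rooted (non-planar) trees up to isomorphism: the least fixed point of the finite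
multiset functor, that is, a rooted tree is the finite multiset of the rooted trees hanging
from its root. -/
def RTree : Type := QPF.Fix Multiset.{0}

/-- Finite rooted forests up to isomorphism: finite multisets of rooted trees. The empty forest is
`0`, and disjoint union is `+`. -/
abbrev RForest : Type := Multiset RTree

namespace RTree

noncomputable section

/-- The tree with one root, on which all the trees of the forest `F` are grafted. -/
def node (F : RForest) : RTree := QPF.Fix.mk F

/-- The forest obtained from a tree by deleting its root. -/
def children (t : RTree) : RForest := QPF.Fix.dest t

@[simp] theorem children_node (F : RForest) : (node F).children = F := QPF.Fix.dest_mk F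

@[simp] theorem node_children (t : RTree) : node t.children = t := QPF.Fix.mk_dest t

theorem ind {p : RTree → Prop} (h : ∀ F : RForest, (∀ t ∈ F, p t) → p (node F)) (t : RTree) :
    p t := by
  refine QPF.Fix.ind p (fun F hF => h F ?_) t
  obtain ⟨u, hu, hp⟩ := (QPF.liftp_iff' p F).1 hF
  intro s hs
  rw [← hu] at hs
  change s ∈ (List.ofFn u.2 : Multiset RTree) at hs
  obtain ⟨i, rfl⟩ := (List.mem_ofFn' _ _).1 (Multiset.mem_coe.1 hs)
  exact hp i

instance : WellFoundedRelation RTree where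
  rel s t := s ∈ t.children
  wf := ⟨ind fun F ih => ⟨_, fun s hs => ih s (by simpa using hs)⟩⟩

/-- The one-vertex tree. -/
def dot : RTree := node 0

/-- The admissible cuts of a tree `t`: the multiset of all the pairs `(l, u)`, where `l` is the
lower part (either empty, or a tree with the same root as `t`) and `u` the upper part of `t`. Either
all of `t` is in the upper part, or the root is in the lower part and one chooses a cut of each of
the trees hanging from the root. -/
def cuts (t : RTree) : Multiset (RForest × RForest) :=
  (0, {t}) ::ₘ
    ((t.children.attach.map fun s => cuts s.1).Sections.map Multiset.sum).map
      fun p => ({node p.1}, p.2)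
termination_by t
decreasing_by exact s.2

open Classical in
/-- The multiset of the trees obtained from the tree `t` by choosing a vertex `v` of `t` and adding
an edge from `v` to every root of the forest `G`; there is one term for each vertex `v`, which is
either the root of `t`, or a vertex of one of the trees hanging from it. -/
def graftings (G : RForest) (t : RTree) : Multiset RTree :=
  node (t.children + G) ::ₘ
    t.children.attach.bind fun s =>
      (graftings G s.1).map fun s' => node (s' ::ₘ t.children.erase s.1)
termination_by t
decreasing_by exact s.2

theorem cuts_node (F : RForest) :
    (node F).cuts = (0, {node F}) ::ₘ
      ((F.map cuts).Sections.map Multiset.sum).map fun p => ({node p.1}, p.2) := by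
  rw [cuts, children_node, Multiset.attach_map_val' F cuts]

end

end RTree

open Classical in
/-- The multiset of the forests `F •_v G`, where `v` runs over the vertices of the forest `F`:
`F •_v G` is obtained from `F` and `G` by adding an edge from `v` to every root of `G`. -/
noncomputable def RForest.graftings (F G : RForest) : Multiset RForest :=
  F.bind fun t => (t.graftings G).map fun t' => t' ::ₘ F.erase t

theorem RTree.graftings_node (F G : RForest) :
    (RTree.node F).graftings G = RTree.node (F + G) ::ₘ (F.graftings G).map RTree.node := by
  classical
  rw [RTree.graftings, RTree.children_node, RForest.graftings, Multiset.map_bind]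
  congr 1
  rw [Multiset.attach_bind_coe F fun s =>
    (s.graftings G).map fun s' => RTree.node (s' ::ₘ F.erase s)]
  refine Multiset.bind_congr fun t _ => ?_
  rw [Multiset.map_map]
  simp only [Function.comp_def]

/-! ## The Connes-Kreimer Hopf algebra -/

/-- The vector space with basis the set of rooted forests, with the product induced by disjoint
union of forests. It carries the Hopf algebra structure defined below, not the one of a monoid
algebra. -/
def ConnesKreimer (K : Type*) [CommRing K] : Type _ := AddMonoidAlgebra K RForest

namespace ConnesKreimer

noncomputable section

variable (K : Type*) [CommRing K]

instance : CommRing (ConnesKreimer K) := inferInstanceAs (CommRing (AddMonoidAlgebra K RForest))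

instance : Algebra K (ConnesKreimer K) :=
  inferInstanceAs (Algebra K (AddMonoidAlgebra K RForest))

/-- The basis of rooted forests. -/
def forestBasis : Module.Basis RForest K (ConnesKreimer K) :=
  ⟨AddMonoidAlgebra.coeffLinearEquiv K⟩

/-- A rooted forest, as an element of the Connes-Kreimer algebra. -/
def forest (F : RForest) : ConnesKreimer K := forestBasis K F

/-- A rooted tree, as an element of the Connes-Kreimer algebra. -/
def tree (t : RTree) : ConnesKreimer K := forest K {t}

theorem forest_eq_single (F : RForest) :
    forest K F = (AddMonoidAlgebra.single F 1 : AddMonoidAlgebra K RForest) := rfl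

@[simp] theorem forest_zero : forest K 0 = 1 := rfl

theorem forest_add (F G : RForest) : forest K (F + G) = forest K F * forest K G := by
  have := AddMonoidAlgebra.single_mul_single (R := K) (m₁ := F) (m₂ := G) (r₁ := 1) (r₂ := 1)
  rw [mul_one] at this
  exact this.symm

theorem forest_eq_prod (F : RForest) : forest K F = (F.map (tree K)).prod := by
  induction F using Multiset.induction with
  | empty => simp
  | cons t F ih =>
    rw [← Multiset.singleton_add, forest_add, ih, Multiset.singleton_add, Multiset.map_cons,
      Multiset.prod_cons, tree]

variable {K}

/-- The algebra morphism with prescribed values on trees. -/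
def liftTree {A : Type*} [CommRing A] [Algebra K A] (f : RTree → A) : ConnesKreimer K →ₐ[K] A :=
  AddMonoidAlgebra.lift K A RForest
    { toFun := fun F => (F.toAdd.map f).prod
      map_one' := by simp
      map_mul' := fun F G => by simp }

theorem liftTree_forest {A : Type*} [CommRing A] [Algebra K A] (f : RTree → A) (F : RForest) :
    liftTree f (forest K F) = (F.map f).prod := by
  rw [forest_eq_single]
  exact (AddMonoidAlgebra.lift_single _ _ _).trans (one_smul _ _)

@[simp] theorem liftTree_tree {A : Type*} [CommRing A] [Algebra K A] (f : RTree → A) (t : RTree) :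
    liftTree f (tree K t) = f t := by
  simp [tree, liftTree_forest]

theorem algHom_forest {A : Type*} [CommRing A] [Algebra K A] (f : ConnesKreimer K →ₐ[K] A)
    (F : RForest) : f (forest K F) = (F.map fun t => f (tree K t)).prod := by
  rw [forest_eq_prod, map_multiset_prod, Multiset.map_map]; rfl

theorem algHom_ext {A : Type*} [CommRing A] [Algebra K A] {f g : ConnesKreimer K →ₐ[K] A}
    (h : ∀ t, f (tree K t) = g (tree K t)) : f = g := by
  have : f.toLinearMap = g.toLinearMap := (forestBasis K).ext fun F => by
    change f (forest K F) = g (forest K F)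
    simp [algHom_forest, h]
  exact AlgHom.toLinearMap_injective this

variable (K)

/-- The counit: the coefficient of the empty forest. -/
def counitHom : ConnesKreimer K →ₐ[K] K := liftTree fun _ => 0

/-- The coproduct: the algebra morphism that sends a tree to the sum of `l ⊗ u` over its admissible
cuts, with the lower part `l` on the left and the upper part `u` on the right. -/
def comulHom : ConnesKreimer K →ₐ[K] ConnesKreimer K ⊗[K] ConnesKreimer K :=
  liftTree fun t => (t.cuts.map fun p => forest K p.1 ⊗ₜ[K] forest K p.2).sum

/-- The grafting operator, sending a forest `F` to the tree whose root carries the trees of `F`. -/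
def graftRoot : ConnesKreimer K →ₗ[K] ConnesKreimer K :=
  (forestBasis K).constr K fun F => tree K (RTree.node F)

@[simp] theorem graftRoot_forest (F : RForest) :
    graftRoot K (forest K F) = tree K (RTree.node F) := by
  simp [graftRoot, forest]

theorem prod_map_sum_cuts (s : Multiset (Multiset (RForest × RForest))) :
    (s.map fun m => (m.map fun p => forest K p.1 ⊗ₜ[K] forest K p.2).sum).prod =
      ((s.Sections.map Multiset.sum).map fun p => forest K p.1 ⊗ₜ[K] forest K p.2).sum := by
  have h : (fun m : Multiset (RForest × RForest) =>
      (m.map fun p => forest K p.1 ⊗ₜ[K] forest K p.2).prod) =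
      fun m => forest K m.sum.1 ⊗ₜ[K] forest K m.sum.2 := by
    funext m
    induction m using Multiset.induction with
    | empty => simp [Algebra.TensorProduct.one_def]
    | cons p m ih =>
      simp only [Multiset.map_cons, Multiset.prod_cons, Multiset.sum_cons, ih, Prod.fst_add,
        Prod.snd_add, forest_add, Algebra.TensorProduct.tmul_mul_tmul]
  rw [Multiset.map_map]
  change _ = (s.Sections.map fun m => forest K m.sum.1 ⊗ₜ[K] forest K m.sum.2).sum
  rw [← h]
  induction s using Multiset.induction with
  | empty => simp
  | cons a s ih =>
    simp only [Multiset.map_cons, Multiset.prod_cons, ih, Multiset.sections_cons,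
      Multiset.map_bind, Multiset.map_map, Function.comp_def, Multiset.sum_bind,
      Multiset.sum_map_mul_left, Multiset.sum_map_mul_right]

theorem comul_graftRoot (x : ConnesKreimer K) :
    comulHom K (graftRoot K x) =
      1 ⊗ₜ[K] graftRoot K x + (graftRoot K).rTensor (ConnesKreimer K) (comulHom K x) := by
  suffices h : (comulHom K).toLinearMap ∘ₗ graftRoot K =
      TensorProduct.mk K (ConnesKreimer K) (ConnesKreimer K) 1 ∘ₗ graftRoot K +
        (graftRoot K).rTensor (ConnesKreimer K) ∘ₗ (comulHom K).toLinearMap from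
    LinearMap.congr_fun h x
  refine (forestBasis K).ext fun F => ?_
  change comulHom K (graftRoot K (forest K F)) = 1 ⊗ₜ[K] graftRoot K (forest K F) +
    (graftRoot K).rTensor (ConnesKreimer K) (comulHom K (forest K F))
  have h : comulHom K (forest K F) = (((F.map RTree.cuts).Sections.map Multiset.sum).map
      fun p => forest K p.1 ⊗ₜ[K] forest K p.2).sum := by
    rw [← prod_map_sum_cuts, comulHom, liftTree_forest, Multiset.map_map]
    rfl
  rw [h, graftRoot_forest, comulHom, liftTree_tree, RTree.cuts_node, Multiset.map_cons,
    Multiset.sum_cons, map_multiset_sum]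
  simp only [Multiset.map_map]
  congr 2
  refine Multiset.map_congr rfl fun p _ => ?_
  simp [tree]

theorem tree_node (F : RForest) : tree K (RTree.node F) = graftRoot K (forest K F) := by simp

@[simp] theorem counit_graftRoot (x : ConnesKreimer K) : counitHom K (graftRoot K x) = 0 := by
  suffices h : (counitHom K).toLinearMap ∘ₗ graftRoot K = 0 from LinearMap.congr_fun h x
  refine (forestBasis K).ext fun F => ?_
  change counitHom K (graftRoot K (forest K F)) = 0
  rw [graftRoot_forest, counitHom, liftTree_tree]

/-- To compare two algebra morphisms, it is enough to compare them after the grafting operator. -/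
theorem algHom_ext_graftRoot {A : Type*} [CommRing A] [Algebra K A] {f g : ConnesKreimer K →ₐ[K] A}
    (h : ∀ x, f x = g x → f (graftRoot K x) = g (graftRoot K x)) : f = g := by
  refine algHom_ext fun t => ?_
  induction t using RTree.ind with
  | h F ih =>
    rw [tree_node]
    refine h _ ?_
    rw [algHom_forest, algHom_forest]
    exact congrArg _ (Multiset.map_congr rfl ih)

theorem assoc_rTensor (w : ConnesKreimer K ⊗[K] ConnesKreimer K) (b : ConnesKreimer K) :
    Algebra.TensorProduct.assoc K K K (ConnesKreimer K) (ConnesKreimer K) (ConnesKreimer K)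
        ((graftRoot K).rTensor (ConnesKreimer K) w ⊗ₜ[K] b) =
      (graftRoot K).rTensor (ConnesKreimer K ⊗[K] ConnesKreimer K)
        (Algebra.TensorProduct.assoc K K K (ConnesKreimer K) (ConnesKreimer K) (ConnesKreimer K)
          (w ⊗ₜ[K] b)) := by
  induction w using TensorProduct.induction_on with
  | zero => simp
  | tmul x y => simp
  | add x y hx hy => simp only [map_add, TensorProduct.add_tmul, hx, hy]

theorem assoc_comul_rTensor (z : ConnesKreimer K ⊗[K] ConnesKreimer K) :
    Algebra.TensorProduct.assoc K K K (ConnesKreimer K) (ConnesKreimer K) (ConnesKreimer K)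
        (Algebra.TensorProduct.map (comulHom K) (AlgHom.id K (ConnesKreimer K))
          ((graftRoot K).rTensor (ConnesKreimer K) z)) =
      1 ⊗ₜ[K] (graftRoot K).rTensor (ConnesKreimer K) z +
      (graftRoot K).rTensor (ConnesKreimer K ⊗[K] ConnesKreimer K)
        (Algebra.TensorProduct.assoc K K K (ConnesKreimer K) (ConnesKreimer K) (ConnesKreimer K)
          (Algebra.TensorProduct.map (comulHom K) (AlgHom.id K (ConnesKreimer K)) z)) := by
  induction z using TensorProduct.induction_on with
  | zero => simp
  | tmul x y =>
    simp only [LinearMap.rTensor_tmul, Algebra.TensorProduct.map_tmul, comul_graftRoot,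
      TensorProduct.add_tmul, map_add, assoc_rTensor]
    simp
  | add x y hx hy =>
    simp only [map_add, TensorProduct.tmul_add, hx, hy]
    abel

theorem map_rTensor {C : Type*} [CommRing C] [Algebra K C] (f : ConnesKreimer K →ₐ[K] C)
    (z : ConnesKreimer K ⊗[K] ConnesKreimer K) :
    Algebra.TensorProduct.map (AlgHom.id K (ConnesKreimer K)) f
        ((graftRoot K).rTensor (ConnesKreimer K) z) =
      (graftRoot K).rTensor C
        (Algebra.TensorProduct.map (AlgHom.id K (ConnesKreimer K)) f z) := by
  induction z using TensorProduct.induction_on with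
  | zero => simp
  | tmul x y => simp
  | add x y hx hy => simp only [map_add, hx, hy]

theorem coassoc :
    (Algebra.TensorProduct.assoc K K K (ConnesKreimer K) (ConnesKreimer K)
        (ConnesKreimer K)).toAlgHom.comp
      ((Algebra.TensorProduct.map (comulHom K) (.id K (ConnesKreimer K))).comp (comulHom K)) =
    (Algebra.TensorProduct.map (.id K (ConnesKreimer K)) (comulHom K)).comp (comulHom K) := by
  refine algHom_ext_graftRoot K fun x hx => ?_
  simp only [AlgHom.comp_apply] at hx ⊢
  change Algebra.TensorProduct.assoc K K K _ _ _ _ = _ at hx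
  change Algebra.TensorProduct.assoc K K K _ _ _ _ = _
  rw [comul_graftRoot, map_add, map_add, map_add, assoc_comul_rTensor, hx, map_rTensor]
  simp only [Algebra.TensorProduct.map_tmul, map_one, AlgHom.id_apply, comul_graftRoot,
    TensorProduct.tmul_add, Algebra.TensorProduct.one_def, Algebra.TensorProduct.assoc_tmul]
  abel

instance : Bialgebra K (ConnesKreimer K) :=
  Bialgebra.ofAlgHom (comulHom K) (counitHom K) (coassoc K)
    (by
      refine algHom_ext_graftRoot K fun x _ => ?_
      have h (z : ConnesKreimer K ⊗[K] ConnesKreimer K) :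
          Algebra.TensorProduct.map (counitHom K) (AlgHom.id K (ConnesKreimer K))
            ((graftRoot K).rTensor (ConnesKreimer K) z) = 0 := by
        induction z using TensorProduct.induction_on with
        | zero => simp
        | tmul x y => simp
        | add x y hx hy => simp only [map_add, hx, hy, add_zero]
      simp [comul_graftRoot, h])
    (by
      refine algHom_ext_graftRoot K fun x hx => ?_
      simp only [AlgHom.comp_apply] at hx ⊢
      rw [comul_graftRoot, map_add, map_rTensor, hx]
      simp)

/-- The element `(id ⊗ S) (Δ t)` for a tree `t`, where `S` is the antipode. -/
def idTensorAntipode (t : RTree) : ConnesKreimer K ⊗[K] ConnesKreimer K :=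
  let z := (graftRoot K).rTensor (ConnesKreimer K)
    (t.children.attach.map fun s => idTensorAntipode s.1).prod
  z - 1 ⊗ₜ[K] LinearMap.mul' K (ConnesKreimer K) z
termination_by t
decreasing_by exact s.2

/-- The antipode, as an algebra morphism. -/
def antipodeHom : ConnesKreimer K →ₐ[K] ConnesKreimer K :=
  liftTree fun t => - LinearMap.mul' K (ConnesKreimer K) ((graftRoot K).rTensor (ConnesKreimer K)
    (t.children.map (idTensorAntipode K)).prod)

theorem idTensorAntipode_eq (t : RTree) :
    Algebra.TensorProduct.map (AlgHom.id K (ConnesKreimer K)) (antipodeHom K)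
      (comulHom K (tree K t)) = idTensorAntipode K t := by
  induction t using RTree.ind with
  | h F ih =>
    have h : Algebra.TensorProduct.map (AlgHom.id K (ConnesKreimer K)) (antipodeHom K)
        (comulHom K (forest K F)) = (F.map (idTensorAntipode K)).prod := by
      rw [← AlgHom.comp_apply, algHom_forest]
      exact congrArg _ (Multiset.map_congr rfl ih)
    rw [tree_node, comul_graftRoot, map_add, map_rTensor, h, idTensorAntipode,
      RTree.children_node, Multiset.attach_map_val' F (idTensorAntipode K),
      Algebra.TensorProduct.map_tmul, ← tree_node, antipodeHom, liftTree_tree,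
      RTree.children_node, map_one, TensorProduct.tmul_neg]
    abel

theorem antipode_graftRoot (x : ConnesKreimer K) :
    antipodeHom K (graftRoot K x) = - LinearMap.mul' K (ConnesKreimer K)
      ((graftRoot K).rTensor (ConnesKreimer K)
        (Algebra.TensorProduct.map (AlgHom.id K (ConnesKreimer K)) (antipodeHom K)
          (comulHom K x))) := by
  suffices h : (antipodeHom K).toLinearMap ∘ₗ graftRoot K = - (LinearMap.mul' K (ConnesKreimer K) ∘ₗ
      (graftRoot K).rTensor (ConnesKreimer K) ∘ₗ
        (Algebra.TensorProduct.map (AlgHom.id K (ConnesKreimer K)) (antipodeHom K)).toLinearMap ∘ₗ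
          (comulHom K).toLinearMap) from
    LinearMap.congr_fun h x
  refine (forestBasis K).ext fun F => ?_
  change antipodeHom K (graftRoot K (forest K F)) = - LinearMap.mul' K (ConnesKreimer K)
      ((graftRoot K).rTensor (ConnesKreimer K)
        (Algebra.TensorProduct.map (AlgHom.id K (ConnesKreimer K)) (antipodeHom K)
          (comulHom K (forest K F))))
  have h : Algebra.TensorProduct.map (AlgHom.id K (ConnesKreimer K)) (antipodeHom K)
      (comulHom K (forest K F)) = (F.map (idTensorAntipode K)).prod := by
    rw [← AlgHom.comp_apply, algHom_forest]
    exact congrArg _ (Multiset.map_congr rfl fun t _ => idTensorAntipode_eq K t)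
  rw [h, graftRoot_forest, antipodeHom, liftTree_tree, RTree.children_node]

/-- The morphism `a ⊗ b ↦ S(a) b`. -/
def antipodeMul : ConnesKreimer K ⊗[K] ConnesKreimer K →ₐ[K] ConnesKreimer K :=
  (Algebra.TensorProduct.lmul' K).comp
    (Algebra.TensorProduct.map (antipodeHom K) (.id K (ConnesKreimer K)))

theorem antipodeMul_tmul (a b : ConnesKreimer K) :
    antipodeMul K (a ⊗ₜ[K] b) = antipodeHom K a * b := by
  simp [antipodeMul]

/-- The convolution product of the antipode and the identity. -/
def antipodeConvId : ConnesKreimer K →ₐ[K] ConnesKreimer K :=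
  (antipodeMul K).comp (comulHom K)

theorem antipodeMul_aux (w : ConnesKreimer K ⊗[K] ConnesKreimer K) (b : ConnesKreimer K) :
    LinearMap.mul' K (ConnesKreimer K) ((graftRoot K).rTensor (ConnesKreimer K)
        (Algebra.TensorProduct.map (AlgHom.id K (ConnesKreimer K)) (antipodeHom K) w)) * b =
      LinearMap.mul' K (ConnesKreimer K) ((graftRoot K).rTensor (ConnesKreimer K)
        (Algebra.TensorProduct.map (AlgHom.id K (ConnesKreimer K)) (antipodeMul K)
          (Algebra.TensorProduct.assoc K K K (ConnesKreimer K) (ConnesKreimer K) (ConnesKreimer K)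
            (w ⊗ₜ[K] b)))) := by
  induction w using TensorProduct.induction_on with
  | zero => simp
  | tmul x y => simp [mul_assoc, antipodeMul_tmul]
  | add x y hx hy => simp only [map_add, TensorProduct.add_tmul, add_mul, hx, hy]

theorem antipodeMul_rTensor (z : ConnesKreimer K ⊗[K] ConnesKreimer K) :
    antipodeMul K ((graftRoot K).rTensor (ConnesKreimer K) z) =
      - LinearMap.mul' K (ConnesKreimer K) ((graftRoot K).rTensor (ConnesKreimer K)
        (Algebra.TensorProduct.map (AlgHom.id K (ConnesKreimer K)) (antipodeMul K)
          (Algebra.TensorProduct.assoc K K K (ConnesKreimer K) (ConnesKreimer K) (ConnesKreimer K)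
            (Algebra.TensorProduct.map (comulHom K) (AlgHom.id K (ConnesKreimer K)) z)))) := by
  induction z using TensorProduct.induction_on with
  | zero => simp
  | tmul x y =>
    rw [LinearMap.rTensor_tmul, antipodeMul_tmul, antipode_graftRoot,
      Algebra.TensorProduct.map_tmul, AlgHom.id_apply, ← antipodeMul_aux, neg_mul]
  | add x y hx hy =>
    simp only [map_add, hx, hy]
    abel

theorem antipodeConvId_graftRoot_aux {x : ConnesKreimer K}
    (hx : Algebra.TensorProduct.map (AlgHom.id K (ConnesKreimer K)) (antipodeConvId K)
      (comulHom K x) = x ⊗ₜ[K] 1) : antipodeConvId K (graftRoot K x) = 0 := by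
  have hc := DFunLike.congr_fun (coassoc K) x
  simp only [AlgHom.comp_apply] at hc
  change Algebra.TensorProduct.assoc K K K _ _ _ _ = _ at hc
  have hm (z : ConnesKreimer K ⊗[K] ConnesKreimer K) :
      Algebra.TensorProduct.map (AlgHom.id K (ConnesKreimer K)) (antipodeMul K)
        (Algebra.TensorProduct.map (AlgHom.id K (ConnesKreimer K)) (comulHom K) z) =
      Algebra.TensorProduct.map (AlgHom.id K (ConnesKreimer K)) (antipodeConvId K) z := by
    induction z using TensorProduct.induction_on with
    | zero => simp
    | tmul x y => simp [antipodeConvId]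
    | add x y hx hy => simp only [map_add, hx, hy]
  rw [antipodeConvId, AlgHom.comp_apply, comul_graftRoot, map_add, antipodeMul_rTensor, hc, hm,
    hx, antipodeMul_tmul]
  simp

theorem map_antipodeConvId (x : ConnesKreimer K) :
    Algebra.TensorProduct.map (AlgHom.id K (ConnesKreimer K)) (antipodeConvId K)
      (comulHom K x) = x ⊗ₜ[K] 1 := by
  suffices h : (Algebra.TensorProduct.map (AlgHom.id K (ConnesKreimer K)) (antipodeConvId K)).comp
      (comulHom K) = Algebra.TensorProduct.includeLeft from DFunLike.congr_fun h x
  refine algHom_ext_graftRoot K fun x hx => ?_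
  simp only [AlgHom.comp_apply, Algebra.TensorProduct.includeLeft_apply] at hx ⊢
  rw [comul_graftRoot, map_add, map_rTensor, hx, Algebra.TensorProduct.map_tmul,
    antipodeConvId_graftRoot_aux K hx]
  simp

theorem antipode_left :
    antipodeConvId K = (Algebra.ofId K (ConnesKreimer K)).comp (counitHom K) := by
  refine algHom_ext_graftRoot K fun x _ => ?_
  rw [antipodeConvId_graftRoot_aux K (map_antipodeConvId K x), AlgHom.comp_apply,
    counit_graftRoot, map_zero]

theorem antipode_right :
    ((Algebra.TensorProduct.lmul' K).comp
      (Algebra.TensorProduct.map (.id K (ConnesKreimer K)) (antipodeHom K))).comp (comulHom K) =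
    (Algebra.ofId K (ConnesKreimer K)).comp (counitHom K) := by
  refine algHom_ext_graftRoot K fun x _ => ?_
  rw [AlgHom.comp_apply, AlgHom.comp_apply, AlgHom.comp_apply, counit_graftRoot, comul_graftRoot,
    map_add, map_rTensor, Algebra.TensorProduct.map_tmul, antipode_graftRoot, map_add,
    Algebra.TensorProduct.lmul'_apply_tmul, map_one, one_mul, map_zero]
  exact neg_add_cancel _

/-- The Connes-Kreimer Hopf algebra. -/
instance : HopfAlgebra K (ConnesKreimer K) where
  antipode := (antipodeHom K).toLinearMap
  mul_antipode_rTensor_comul := congrArg AlgHom.toLinearMap (antipode_left K)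
  mul_antipode_lTensor_comul := congrArg AlgHom.toLinearMap (antipode_right K)

/-- The preLie product of the Connes-Kreimer algebra: `F • G` is the sum of the forests `F •_v G`
over all the vertices `v` of `F`. -/
def preLie : ConnesKreimer K →ₗ[K] ConnesKreimer K →ₗ[K] ConnesKreimer K :=
  (forestBasis K).constr K fun F => (forestBasis K).constr K fun G =>
    ((F.graftings G).map (forest K)).sum

/-- The generators of the Connes-Moscovici subalgebra: `δ_1` is the one-vertex tree, and
`δ_n = δ_{n-1} • δ_1` for `n ≥ 2`. The value at `n = 0` is not used. -/
def delta : ℕ → ConnesKreimer K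
  | 0 => 0
  | 1 => tree K RTree.dot
  | n + 2 => preLie K (delta (n + 1)) (tree K RTree.dot)

end

end ConnesKreimer

/-! ## Multi-indices -/

/-- The set of the multi-indices `(i_1, …, i_n)` such that `1 i_1 + … + n i_n = n`; the entry
`i_{k+1}` is `i k`, for `k : Fin n`. -/
def weightedIndices (n : ℕ) : Finset (Fin n → ℕ) :=
  (Fintype.piFinset fun _ => Finset.range (n + 1)).filter fun i =>
    ∑ k : Fin n, ((k : ℕ) + 1) * i k = n

theorem mem_weightedIndices {n : ℕ} {i : Fin n → ℕ} :
    i ∈ weightedIndices n ↔ ∑ k : Fin n, ((k : ℕ) + 1) * i k = n := by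
  simp only [weightedIndices, Finset.mem_filter, Fintype.mem_piFinset, Finset.mem_range,
    and_iff_right_iff_imp]
  intro h k
  have h1 : ((k : ℕ) + 1) * i k ≤ n :=
    (Finset.single_le_sum (f := fun k : Fin n => ((k : ℕ) + 1) * i k)
      (fun _ _ => Nat.zero_le _) (Finset.mem_univ k)).trans h.le
  nlinarith [Nat.zero_le ((k : ℕ) * i k)]

/-- The family `a` is a family of coefficients of the antipode of the elements `δ_n`: for all
`n ≥ 1`, `S(δ_n)` is the sum of the `a_{i_1, …, i_n} δ_1 ^ i_1 ⋯ δ_n ^ i_n` over the multi-indices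
such that `1 i_1 + … + n i_n = n`. -/
def IsAntipodeExpansion (K : Type*) [CommRing K] (a : (n : ℕ) → (Fin n → ℕ) → K) : Prop :=
  ∀ n : ℕ, 1 ≤ n → HopfAlgebra.antipode K (ConnesKreimer.delta K n) =
    ∑ i ∈ weightedIndices n, a n i • ∏ k : Fin n, ConnesKreimer.delta K ((k : ℕ) + 1) ^ i k

/-- The position just before the position `j` (used when `j` is not the first position). -/
def predPosition {n : ℕ} (j : Fin n) : Fin n :=
  ⟨(j : ℕ) - 1, lt_of_le_of_lt (Nat.sub_le _ _) j.isLt⟩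

/-- The multi-index obtained from `i` by subtracting one at the position `j` and adding one at the
position just before `j`. -/
def shiftIndex {n : ℕ} (i : Fin n → ℕ) (j : Fin n) : Fin n → ℕ := fun k =>
  if k = j then i k - 1 else if (k : ℕ) + 1 = j then i k + 1 else i k

/-- The multi-index obtained from `i` by subtracting one at the first position. -/
def decrFirst {n : ℕ} (i : Fin n → ℕ) : Fin n → ℕ := fun k =>
  if (k : ℕ) = 0 then i k - 1 else i k

/-! Write `D` for the grafting of the one-vertex tree on all vertices (so `D δ_n = δ_{n+1}`) and `Y`
for the grafting of the empty forest, which multiplies a forest by its number of vertices. Both are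
derivations. An admissible cut of a grafted forest either keeps the new leaf on the side of the
vertex carrying it, or separates it from a vertex of the lower part. Hence `Δ D = (D ⊗ id + id ⊗ D +
(1 ⊗ δ_1)(Y ⊗ id)) Δ` (`comul_graftDer`). Since `id` is invertible for convolution, with inverse
`S`, this transfers to the antipode: `S D = D S - δ_1 · S Y` (`antipode_graftDer_dot`). As `Y δ_n =
n δ_n`, this gives `S(δ_{n+1}) = D S(δ_n) - n δ_1 S(δ_n)` (`antipode_delta_succ`). On polynomials in
the `δ_k`, `D` is the derivation sending each variable to the next, so `S(δ_n)` is the value of an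
explicit polynomial, homogeneous of weight `n`. This gives existence. The `δ_k` are algebraically
independent because corollas detect them (`evalDelta_injective`), so any coefficients as in the
statement are those of this polynomial, and the recursion is read off monomial by monomial
(`coeff_antipodePoly_succ`). -/

/-! ### Grafting as a derivation -/

theorem RForest.graftings_add (F G H : RForest) :
    (F + G).graftings H =
      (F.graftings H).map (fun F' => F' + G) + (G.graftings H).map (fun G' => F + G') := by
  classical
  simp only [RForest.graftings, Multiset.add_bind, Multiset.map_bind, Multiset.map_map,
    Function.comp_def]
  congr 1
  · refine Multiset.bind_congr fun t ht => Multiset.map_congr rfl fun t' _ => ?_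
    rw [Multiset.erase_add_left_pos _ ht, Multiset.cons_add]
  · refine Multiset.bind_congr fun t ht => Multiset.map_congr rfl fun t' _ => ?_
    rw [Multiset.erase_add_right_pos _ ht, Multiset.add_cons]

theorem RForest.graftings_singleton (t : RTree) (H : RForest) :
    RForest.graftings {t} H = (t.graftings H).map fun t' => {t'} := by
  classical
  simp [RForest.graftings]

namespace ConnesKreimer

noncomputable section

variable (K : Type*) [CommRing K]

theorem bilin_ext_forest {M : Type*} [AddCommGroup M] [Module K M]
    {f g : ConnesKreimer K →ₗ[K] ConnesKreimer K →ₗ[K] M}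
    (h : ∀ F G, f (forest K F) (forest K G) = g (forest K F) (forest K G)) : f = g :=
  (forestBasis K).ext fun F => (forestBasis K).ext fun G => h F G

@[simp] theorem preLie_forest (F G : RForest) :
    preLie K (forest K F) (forest K G) = ((F.graftings G).map (forest K)).sum := by
  simp [preLie, forest]

/-- Grafting a fixed forest on all the vertices, as a linear endomorphism. -/
def graft (G : RForest) : ConnesKreimer K →ₗ[K] ConnesKreimer K := (preLie K).flip (forest K G)

variable {K}

theorem graft_forest (F G : RForest) :
    graft K G (forest K F) = ((F.graftings G).map (forest K)).sum := by
  simp [graft]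

/-- A vertex of a disjoint union lies in exactly one of the two forests (`RForest.graftings_add`);
this is the Leibniz rule on the basis. -/
theorem graft_mul (G : RForest) (x y : ConnesKreimer K) :
    graft K G (x * y) = graft K G x * y + x * graft K G y := by
  have h : (LinearMap.mul K (ConnesKreimer K)).compr₂ (graft K G) =
      (LinearMap.mul K (ConnesKreimer K)).comp (graft K G) +
        (LinearMap.mul K (ConnesKreimer K)).compl₂ (graft K G) := by
    refine bilin_ext_forest K fun E F => ?_
    simp only [LinearMap.compr₂_apply, LinearMap.mul_apply', LinearMap.add_apply,
      LinearMap.comp_apply, LinearMap.compl₂_apply, ← forest_add, graft_forest,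
      RForest.graftings_add, Multiset.map_add, Multiset.sum_add, Multiset.map_map,
      Function.comp_def]
    simp only [forest_add, Multiset.sum_map_mul_left, Multiset.sum_map_mul_right]
  exact LinearMap.congr_fun₂ h x y

/-- Grafting a fixed forest on all the vertices is a derivation. -/
def graftDer (G : RForest) : Derivation K (ConnesKreimer K) (ConnesKreimer K) :=
  Derivation.mk' (graft K G) fun x y => by
    rw [graft_mul, smul_eq_mul, smul_eq_mul, mul_comm y, add_comm]

theorem coe_graftDer (G : RForest) :
    ((graftDer G : Derivation K _ _) : ConnesKreimer K →ₗ[K] ConnesKreimer K) = graft K G := rfl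

theorem graft_eq_graftDer (G : RForest) (x : ConnesKreimer K) : graft K G x = graftDer G x := rfl

/-- The vertex receiving `G` is either the new root, which adds `G` to its children, or a vertex of
`x`. Later inductions on trees use grafting only through this identity. -/
theorem graftDer_graftRoot (G : RForest) (x : ConnesKreimer K) :
    graftDer G (graftRoot K x) = graftRoot K (graftDer G x + forest K G * x) := by
  suffices h : graft K G ∘ₗ graftRoot K =
      graftRoot K ∘ₗ (graft K G + LinearMap.mul K _ (forest K G)) from LinearMap.congr_fun h x
  refine (forestBasis K).ext fun F => ?_
  change graft K G (graftRoot K (forest K F)) =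
    graftRoot K (graft K G (forest K F) + forest K G * forest K F)
  rw [graftRoot_forest, tree, graft_forest, RForest.graftings_singleton, RTree.graftings_node,
    graft_forest, map_add, ← forest_add, graftRoot_forest, map_multiset_sum, add_comm G F]
  simp only [Multiset.map_cons, Multiset.sum_cons, Multiset.map_map, Function.comp_def,
    graftRoot_forest]
  exact add_comm _ _

/-! ### Comparing derivations on trees -/

/-- Two linear maps that are derivations along the same algebra morphism are equal as soon as they
agree after the grafting operator. -/
theorem derivationAlong_ext {A : Type*} [CommRing A] [Algebra K A] (φ : ConnesKreimer K →ₐ[K] A)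
    {f g : ConnesKreimer K →ₗ[K] A}
    (hf : ∀ x y, f (x * y) = f x * φ y + φ x * f y)
    (hg : ∀ x y, g (x * y) = g x * φ y + φ x * g y)
    (h : ∀ x, f x = g x → f (graftRoot K x) = g (graftRoot K x)) : f = g := by
  have hf1 : f 1 = 0 := by simpa using hf 1 1
  have hg1 : g 1 = 0 := by simpa using hg 1 1
  have key (F : RForest) (hF : ∀ t ∈ F, f (tree K t) = g (tree K t)) :
      f (forest K F) = g (forest K F) := by
    induction F using Multiset.induction with
    | empty => simp [hf1, hg1]
    | cons t F ih =>
      rw [← Multiset.singleton_add, forest_add, hf, hg,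
        ih fun s hs => hF s (Multiset.mem_cons_of_mem hs)]
      have := hF t (Multiset.mem_cons_self t F)
      rw [tree] at this
      rw [this]
  have ht (t : RTree) : f (tree K t) = g (tree K t) := by
    induction t using RTree.ind with
    | h F ih =>
      rw [tree_node]
      exact h _ (key F ih)
  exact (forestBasis K).ext fun F => key F fun t _ => ht t

theorem derivation_ext_graftRoot {d e : Derivation K (ConnesKreimer K) (ConnesKreimer K)}
    (h : ∀ x, d x = e x → d (graftRoot K x) = e (graftRoot K x)) : d = e := by
  have hl (d : Derivation K (ConnesKreimer K) (ConnesKreimer K)) (x y : ConnesKreimer K) :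
      (d : ConnesKreimer K →ₗ[K] ConnesKreimer K) (x * y) =
        d x * AlgHom.id K _ y + AlgHom.id K _ x * d y := by
    simp [mul_comm, add_comm]
  ext x
  exact LinearMap.congr_fun (derivationAlong_ext (AlgHom.id K _) (hl d) (hl e) h) x

/-- `hG` encodes that `G` has `n` vertices, and grafting `G` raises the number of vertices by `n`.
The commutator is a derivation, so it suffices to test it after `graftRoot`. -/
theorem graftDer_zero_commutator (G : RForest) (n : ℕ)
    (hG : graftDer 0 (forest K G) = (n : ConnesKreimer K) * forest K G) (x : ConnesKreimer K) :
    graftDer 0 (graftDer G x) = graftDer G (graftDer 0 x) + (n : ConnesKreimer K) * graftDer G x := by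
  suffices h : ⁅graftDer 0, graftDer G⁆ = (n : ConnesKreimer K) • graftDer (K := K) G by
    have := DFunLike.congr_fun h x
    rw [Derivation.commutator_apply, Derivation.smul_apply, smul_eq_mul] at this
    rw [← this]; abel
  refine derivation_ext_graftRoot fun x hx => ?_
  rw [Derivation.commutator_apply, Derivation.smul_apply, smul_eq_mul] at hx ⊢
  have hn (z : ConnesKreimer K) :
      (n : ConnesKreimer K) * graftRoot K z = graftRoot K ((n : ConnesKreimer K) * z) := by
    rw [← nsmul_eq_mul, ← nsmul_eq_mul, map_nsmul]
  simp only [graftDer_graftRoot, hn, forest_zero, one_mul, map_add, mul_add,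
    Derivation.leibniz, smul_eq_mul, hG] at hx ⊢
  simp only [← map_add, ← map_sub]
  congr 1
  linear_combination hx

/-! ### Coproduct of a grafting -/

/-- `d` acting on the left tensor factor. -/
def _root_.Derivation.rTensorSelf {H : Type*} [CommRing H] [Algebra K H] (d : Derivation K H H) :
    Derivation K (H ⊗[K] H) (H ⊗[K] H) :=
  Derivation.mk' ((d : H →ₗ[K] H).rTensor H) fun a b => by
    induction a using TensorProduct.induction_on with
    | zero => simp
    | add a a' h h' => simp only [add_mul, map_add, h, h', smul_eq_mul, mul_add]; ring
    | tmul x y =>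
      induction b using TensorProduct.induction_on with
      | zero => simp
      | add a a' h h' => simp only [add_mul, map_add, h, h', smul_eq_mul, mul_add]; ring
      | tmul x' y' =>
        simp [TensorProduct.add_tmul, mul_comm]

/-- `d` acting on the right tensor factor. -/
def _root_.Derivation.lTensorSelf {H : Type*} [CommRing H] [Algebra K H] (d : Derivation K H H) :
    Derivation K (H ⊗[K] H) (H ⊗[K] H) :=
  Derivation.mk' ((d : H →ₗ[K] H).lTensor H) fun a b => by
    induction a using TensorProduct.induction_on with
    | zero => simp
    | add a a' h h' => simp only [add_mul, map_add, h, h', smul_eq_mul, mul_add]; ring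
    | tmul x y =>
      induction b using TensorProduct.induction_on with
      | zero => simp
      | add a a' h h' => simp only [add_mul, map_add, h, h', smul_eq_mul, mul_add]; ring
      | tmul x' y' =>
        simp [TensorProduct.tmul_add, mul_comm]

/-- The derivation of the tensor square that describes the coproduct of a grafting: the grafted
forest is either grafted on the left, or on the right, or its part `c` is cut off a vertex on the
left. -/
def graftDerTensor (G : RForest) (c : ConnesKreimer K) :
    Derivation K (ConnesKreimer K ⊗[K] ConnesKreimer K) (ConnesKreimer K ⊗[K] ConnesKreimer K) :=
  (graftDer G).rTensorSelf + (graftDer G).lTensorSelf +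
    ((1 : ConnesKreimer K) ⊗ₜ[K] c) • (graftDer 0).rTensorSelf

theorem graftDerTensor_tmul (G : RForest) (c x y : ConnesKreimer K) :
    graftDerTensor G c (x ⊗ₜ[K] y) = graftDer G x ⊗ₜ[K] y + x ⊗ₜ[K] graftDer G y +
      graftDer 0 x ⊗ₜ[K] (c * y) := by
  simp [graftDerTensor, Derivation.rTensorSelf, Derivation.lTensorSelf]

/-- Tensor counterpart of `graftDer_graftRoot`: the factor `G ⊗ 1 + 1 ⊗ c` records whether a forest
grafted on the root stays below or is cut off. -/
theorem graftDerTensor_rTensor_graftRoot (G : RForest) (c : ConnesKreimer K)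
    (z : ConnesKreimer K ⊗[K] ConnesKreimer K) :
    graftDerTensor G c ((graftRoot K).rTensor (ConnesKreimer K) z) =
      (graftRoot K).rTensor (ConnesKreimer K)
        (graftDerTensor G c z + (forest K G ⊗ₜ[K] 1 + 1 ⊗ₜ[K] c) * z) := by
  induction z using TensorProduct.induction_on with
  | zero => simp
  | tmul x y =>
    simp [graftDerTensor_tmul, graftDer_graftRoot, TensorProduct.add_tmul, add_mul]
    abel
  | add x y hx hy => simp only [map_add, hx, hy, mul_add]; abel

/-- Both sides are derivations along `Δ`, and they obey the same rule after `graftRoot`. The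
hypothesis covers the one-vertex tree (`c = δ_1`) and the empty forest (`c = 0`). -/
theorem comul_graftDer {G : RForest} {c : ConnesKreimer K}
    (hG : comulHom K (forest K G) = forest K G ⊗ₜ[K] 1 + 1 ⊗ₜ[K] c) (x : ConnesKreimer K) :
    comulHom K (graftDer G x) = graftDerTensor G c (comulHom K x) := by
  suffices h : (comulHom K).toLinearMap ∘ₗ graft K G =
      (graftDerTensor G c).toLinearMap ∘ₗ (comulHom K).toLinearMap from LinearMap.congr_fun h x
  refine derivationAlong_ext (comulHom K) (fun x y => ?_) (fun x y => ?_) fun x hx => ?_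
  · change comulHom K (graftDer G (x * y)) = comulHom K (graftDer G x) * _ +
      _ * comulHom K (graftDer G y)
    rw [Derivation.leibniz, map_add, smul_eq_mul, smul_eq_mul, map_mul, map_mul]
    ring
  · change graftDerTensor G c (comulHom K (x * y)) = graftDerTensor G c (comulHom K x) * _ +
      _ * graftDerTensor G c (comulHom K y)
    rw [map_mul, Derivation.leibniz, smul_eq_mul, smul_eq_mul]
    ring
  · change comulHom K (graftDer G x) = graftDerTensor G c (comulHom K x) at hx
    change comulHom K (graftDer G (graftRoot K x)) =
      graftDerTensor G c (comulHom K (graftRoot K x))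
    rw [comul_graftRoot, map_add, graftDerTensor_rTensor_graftRoot, graftDerTensor_tmul, ← hx,
      ← hG, ← map_mul, ← map_add, graftDer_graftRoot, comul_graftRoot]
    simp

theorem counit_graftDer (G : RForest) (x : ConnesKreimer K) :
    counitHom K (graftDer G x) = 0 := by
  suffices h : (counitHom K).toLinearMap ∘ₗ graft K G =
      0 from LinearMap.congr_fun h x
  refine derivationAlong_ext (counitHom K) (fun x y => ?_) (fun x y => by simp) fun x _ => ?_
  · change counitHom K (graftDer G (x * y)) = counitHom K (graftDer G x) * _ +
      _ * counitHom K (graftDer G y)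
    rw [Derivation.leibniz, map_add, smul_eq_mul, smul_eq_mul, map_mul, map_mul]
    ring
  · change counitHom K (graftDer G (graftRoot K x)) = 0
    rw [graftDer_graftRoot, counit_graftRoot]

/-! ### Antipode of a grafting -/

/-- The convolution product of two linear endomorphisms, evaluated at an element. -/
def convolution (f g : ConnesKreimer K →ₗ[K] ConnesKreimer K) (x : ConnesKreimer K) :
    ConnesKreimer K :=
  LinearMap.mul' K _ (TensorProduct.map f g (comulHom K x))

/-- Convolve on the left with the antipode, the inverse of the identity. -/
theorem conv_id_left_cancel {f g : ConnesKreimer K →ₗ[K] ConnesKreimer K}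
    (h : ∀ x, convolution .id f x = convolution .id g x) : f = g := by
  have h' : WithConv.toConv LinearMap.id * WithConv.toConv f =
      WithConv.toConv LinearMap.id * WithConv.toConv g := by
    ext x; exact h x
  have := congrArg (WithConv.toConv (HopfAlgebra.antipode K (A := ConnesKreimer K)) * ·) h'
  simp only [← mul_assoc, LinearMap.antipode_mul_id, one_mul] at this
  exact WithConv.toConv_injective this

theorem conv_id_antipode (x : ConnesKreimer K) :
    convolution .id (antipodeHom K).toLinearMap x = algebraMap K _ (counitHom K x) :=
  DFunLike.congr_fun (antipode_right K) x

theorem derivation_mul_map_id (d : Derivation K (ConnesKreimer K) (ConnesKreimer K))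
    (f : ConnesKreimer K →ₗ[K] ConnesKreimer K) (z : ConnesKreimer K ⊗[K] ConnesKreimer K) :
    d (LinearMap.mul' K _ (TensorProduct.map .id f z)) =
      LinearMap.mul' K _ (TensorProduct.map (d : _ →ₗ[K] _) f z) +
        LinearMap.mul' K _ (TensorProduct.map .id ((d : _ →ₗ[K] _) ∘ₗ f) z) := by
  induction z using TensorProduct.induction_on with
  | zero => simp
  | tmul x y => simp [mul_comm, add_comm]
  | add x y hx hy => simp only [map_add, hx, hy]; abel

/-- Apply the derivation to `id * S = ε`: it kills the scalars on the right, and the Leibniz rule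
splits the left. -/
theorem conv_graftDer_antipode (G : RForest) (x : ConnesKreimer K) :
    convolution (graft K G) (antipodeHom K).toLinearMap x =
      - convolution .id (graft K G ∘ₗ (antipodeHom K).toLinearMap) x := by
  rw [eq_neg_iff_add_eq_zero, convolution, convolution, ← coe_graftDer,
    ← derivation_mul_map_id, ← convolution, conv_id_antipode, Derivation.map_algebraMap]

theorem mul_map_graftDerTensor (G : RForest) (c : ConnesKreimer K)
    (z : ConnesKreimer K ⊗[K] ConnesKreimer K) :
    LinearMap.mul' K _ (TensorProduct.map .id (antipodeHom K).toLinearMap (graftDerTensor G c z)) =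
      LinearMap.mul' K _
        (TensorProduct.map (graft K G) (antipodeHom K).toLinearMap z) +
      LinearMap.mul' K _
        (TensorProduct.map .id ((antipodeHom K).toLinearMap ∘ₗ graft K G) z) +
      antipodeHom K c * LinearMap.mul' K _
        (TensorProduct.map (graft K 0) (antipodeHom K).toLinearMap z) := by
  induction z using TensorProduct.induction_on with
  | zero => simp
  | tmul x y => simp [graftDerTensor_tmul, mul_left_comm, graft_eq_graftDer]
  | add x y hx hy => simp only [map_add, hx, hy, mul_add]; abel

/-- Evaluate `id * S = ε` at a grafting, where the counit vanishes, and expand by `comul_graftDer`.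
The terms with the derivation on the left factor are moved to the right by `conv_graftDer_antipode`.
-/
theorem conv_antipode_graftDer {G : RForest} {c : ConnesKreimer K}
    (hG : comulHom K (forest K G) = forest K G ⊗ₜ[K] 1 + 1 ⊗ₜ[K] c) (x : ConnesKreimer K) :
    convolution .id ((antipodeHom K).toLinearMap ∘ₗ graft K G) x =
      convolution .id (graft K G ∘ₗ (antipodeHom K).toLinearMap) x +
        antipodeHom K c *
          convolution .id (graft K 0 ∘ₗ (antipodeHom K).toLinearMap) x := by
  have h := conv_id_antipode (graftDer G x)
  rw [counit_graftDer, map_zero, convolution, comul_graftDer hG, mul_map_graftDerTensor] at h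
  change convolution _ _ x + convolution _ _ x + _ * convolution _ _ x = 0 at h
  rw [conv_graftDer_antipode, conv_graftDer_antipode] at h
  linear_combination h

theorem conv_id_add_mul (f g : ConnesKreimer K →ₗ[K] ConnesKreimer K) (c x : ConnesKreimer K) :
    convolution .id (f + LinearMap.mulLeft K c ∘ₗ g) x =
      convolution .id f x + c * convolution .id g x := by
  simp only [convolution]
  induction comulHom K x using TensorProduct.induction_on with
  | zero => simp
  | tmul x y => simp [mul_add, mul_left_comm]
  | add x y hx hy => simp only [map_add, hx, hy, mul_add]; abel

theorem antipode_graftDer {G : RForest} {c : ConnesKreimer K}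
    (hG : comulHom K (forest K G) = forest K G ⊗ₜ[K] 1 + 1 ⊗ₜ[K] c) (x : ConnesKreimer K) :
    antipodeHom K (graftDer G x) = graftDer G (antipodeHom K x) +
      antipodeHom K c * graftDer 0 (antipodeHom K x) := by
  refine LinearMap.congr_fun (f := (antipodeHom K).toLinearMap ∘ₗ graft K G)
    (g := graft K G ∘ₗ (antipodeHom K).toLinearMap +
      LinearMap.mulLeft K (antipodeHom K c) ∘ₗ
        graft K 0 ∘ₗ (antipodeHom K).toLinearMap)
    (conv_id_left_cancel fun y => ?_) x
  rw [conv_id_add_mul, conv_antipode_graftDer hG]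

/-- For the empty forest `c = 0`, so the correction term disappears: the antipode preserves the
number of vertices. -/
theorem antipode_graftDer_zero (x : ConnesKreimer K) :
    antipodeHom K (graftDer 0 x) = graftDer 0 (antipodeHom K x) := by
  have h := antipode_graftDer (K := K) (G := 0) (c := 0)
    (by simp [Algebra.TensorProduct.one_def]) x
  simpa using h

theorem graftRoot_one : graftRoot K 1 = tree K RTree.dot := by
  rw [← forest_zero K, graftRoot_forest, RTree.dot]

theorem antipode_dot : antipodeHom K (tree K RTree.dot) = - tree K RTree.dot := by
  simpa [Algebra.TensorProduct.one_def, graftRoot_one] using antipode_graftRoot K 1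

theorem comul_dot : comulHom K (tree K RTree.dot) =
    tree K RTree.dot ⊗ₜ[K] 1 + 1 ⊗ₜ[K] tree K RTree.dot := by
  have := comul_graftRoot K 1
  rw [graftRoot_one, map_one, Algebra.TensorProduct.one_def, LinearMap.rTensor_tmul,
    graftRoot_one] at this
  rw [this, add_comm]

theorem antipode_graftDer_dot (x : ConnesKreimer K) :
    antipodeHom K (graftDer {RTree.dot} x) = graftDer {RTree.dot} (antipodeHom K x) -
      tree K RTree.dot * antipodeHom K (graftDer 0 x) := by
  rw [antipode_graftDer (c := tree K RTree.dot) comul_dot, antipode_dot, antipode_graftDer_zero]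
  ring

/-! ### The recursion for the antipode of `δ_n` -/

theorem delta_one : delta K 1 = tree K RTree.dot := rfl

theorem delta_add_two (n : ℕ) : delta K (n + 2) = graftDer {RTree.dot} (delta K (n + 1)) := rfl

theorem graftDer_zero_dot : graftDer 0 (tree K RTree.dot) = tree K RTree.dot := by
  rw [← graftRoot_one, graftDer_graftRoot]
  simp

/-- Every tree in `δ_{n+1}` has `n + 1` vertices; the commutator with a one-vertex grafting adds one
at each step. -/
theorem graftDer_zero_delta (n : ℕ) :
    graftDer 0 (delta K (n + 1)) = ((n + 1 : ℕ) : ConnesKreimer K) * delta K (n + 1) := by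
  induction n with
  | zero => simp [delta_one, graftDer_zero_dot]
  | succ n ih =>
    rw [delta_add_two, graftDer_zero_commutator {RTree.dot} 1, ih, Derivation.leibniz,
      Derivation.map_natCast]
    · push_cast
      simp only [smul_eq_mul]
      ring
    · rw [Nat.cast_one, one_mul]
      exact graftDer_zero_dot

theorem antipode_delta_succ (n : ℕ) :
    antipodeHom K (delta K (n + 2)) = graftDer {RTree.dot} (antipodeHom K (delta K (n + 1))) -
      ((n + 1 : ℕ) : ConnesKreimer K) * (delta K 1 * antipodeHom K (delta K (n + 1))) := by
  rw [delta_add_two, antipode_graftDer_dot, graftDer_zero_delta, map_mul, map_natCast, delta_one]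
  ring

/-! ### Algebraic independence of the `δ_n` -/

/-- The element whose image under the grafting operator is `δ_{n+1}`. -/
def deltaChildren : ℕ → ConnesKreimer K
  | 0 => 1
  | n + 1 => graftDer {RTree.dot} (deltaChildren n) + tree K RTree.dot * deltaChildren n

theorem delta_eq_graftRoot (n : ℕ) : delta K (n + 1) = graftRoot K (deltaChildren n) := by
  induction n with
  | zero => rw [deltaChildren, graftRoot_one, delta_one]
  | succ n ih => rw [delta_add_two, ih, graftDer_graftRoot, deltaChildren]; rfl

open Classical in
/-- The algebra morphism to polynomials that counts the one-vertex trees of a forest, and vanishes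
on the forests with another tree. -/
def countDots : ConnesKreimer K →ₐ[K] Polynomial K :=
  liftTree fun t => if t = RTree.dot then Polynomial.X else 0

theorem countDots_dot : countDots (tree K RTree.dot) = Polynomial.X := by
  simp [countDots]

theorem countDots_graftRoot (x : ConnesKreimer K) :
    countDots (graftRoot K x) = counitHom K x • Polynomial.X := by
  suffices h : (countDots (K := K)).toLinearMap ∘ₗ graftRoot K =
      LinearMap.toSpanSingleton K _ Polynomial.X ∘ₗ (counitHom K).toLinearMap from
    LinearMap.congr_fun h x
  refine (forestBasis K).ext fun F => ?_
  change countDots (graftRoot K (forest K F)) = counitHom K (forest K F) • Polynomial.X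
  rw [graftRoot_forest, countDots, liftTree_tree, counitHom, liftTree_forest]
  by_cases hF : F = 0
  · simp [hF, RTree.dot]
  · obtain ⟨t, ht⟩ := Multiset.exists_mem_of_ne_zero hF
    have h1 : RTree.node F ≠ RTree.dot := fun h => hF (by
      simpa [RTree.dot] using congrArg RTree.children h)
    rw [if_neg h1, Multiset.prod_eq_zero (Multiset.mem_map.2 ⟨t, ht, rfl⟩), zero_smul]

theorem counit_dot : counitHom K (tree K RTree.dot) = 0 := by
  rw [← graftRoot_one, counit_graftRoot]

/-- A grafting creates a tree with at least two vertices, which `countDots` kills. -/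
theorem countDots_graftDer_dot (x : ConnesKreimer K) :
    countDots (graftDer {RTree.dot} x) = 0 := by
  suffices h : (countDots (K := K)).toLinearMap ∘ₗ graft K {RTree.dot} = 0 from
    LinearMap.congr_fun h x
  refine derivationAlong_ext countDots (fun x y => ?_) (fun x y => by simp) fun x _ => ?_
  · simp only [LinearMap.comp_apply, graft_mul, AlgHom.toLinearMap_apply, map_add, map_mul]
  · change countDots (graftDer {RTree.dot} (graftRoot K x)) = 0
    rw [graftDer_graftRoot, countDots_graftRoot, map_add, counit_graftDer, map_mul]
    change (0 + counitHom K (tree K RTree.dot) * _) • _ = _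
    rw [counit_dot]
    simp

/-- Only the term that always grafts on the root survives. Thus the only corolla in `δ_{n+1}` is the
one with `n` leaves, with coefficient one. -/
theorem countDots_deltaChildren (n : ℕ) :
    countDots (deltaChildren n : ConnesKreimer K) = Polynomial.X ^ n := by
  induction n with
  | zero => simp [deltaChildren]
  | succ n ih =>
    rw [deltaChildren, map_add, countDots_graftDer_dot, map_mul, countDots_dot, ih, zero_add,
      pow_succ']

/-- The linear map that sends `X ^ n` to the variable `X_n`. -/
def powToVar : Polynomial K →ₗ[K] MvPolynomial ℕ K :=
  (Polynomial.basisMonomials K).constr K MvPolynomial.X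

theorem powToVar_X_pow (n : ℕ) : powToVar (Polynomial.X ^ n : Polynomial K) = MvPolynomial.X n := by
  have h := (Polynomial.basisMonomials K).constr_basis K (MvPolynomial.X (R := K)) n
  rw [Polynomial.coe_basisMonomials] at h
  rwa [Polynomial.X_pow_eq_monomial]

/-- The algebra morphism that sends the corolla with `n` leaves to the variable `X_n`, and the other
trees to `0`. -/
def corollaVar : ConnesKreimer K →ₐ[K] MvPolynomial ℕ K :=
  liftTree fun t => powToVar (countDots (forest K t.children))

theorem corollaVar_graftRoot (x : ConnesKreimer K) :
    corollaVar (graftRoot K x) = powToVar (countDots x) := by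
  suffices h : (corollaVar (K := K)).toLinearMap ∘ₗ graftRoot K =
      powToVar ∘ₗ (countDots (K := K)).toLinearMap from LinearMap.congr_fun h x
  refine (forestBasis K).ext fun F => ?_
  change corollaVar (graftRoot K (forest K F)) = powToVar (countDots (forest K F))
  rw [graftRoot_forest, corollaVar, liftTree_tree, RTree.children_node]

theorem corollaVar_delta (n : ℕ) : corollaVar (delta K (n + 1)) = MvPolynomial.X n := by
  rw [delta_eq_graftRoot, corollaVar_graftRoot, countDots_deltaChildren, powToVar_X_pow]

variable (K) in
/-- The algebra morphism that sends the variable `X_n` to `δ_{n+1}`. -/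
def evalDelta : MvPolynomial ℕ K →ₐ[K] ConnesKreimer K :=
  MvPolynomial.aeval fun n => delta K (n + 1)

/-- `corollaVar` is a left inverse, sending `δ_{n+1}` back to `X_n`. -/
theorem evalDelta_injective : Function.Injective (evalDelta K) := by
  have h : (corollaVar (K := K)).comp (evalDelta K) = AlgHom.id K _ := by
    ext n : 1
    simp [evalDelta, corollaVar_delta]
  exact Function.LeftInverse.injective (g := corollaVar) fun p => DFunLike.congr_fun h p

/-! ### The antipode as a polynomial in the `δ_n` -/

variable (K) in
/-- The derivation of polynomials that sends each variable to the next one. -/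
def shiftDer : Derivation K (MvPolynomial ℕ K) (MvPolynomial ℕ K) :=
  MvPolynomial.mkDerivation K fun n => MvPolynomial.X (n + 1)

theorem evalDelta_shiftDer (p : MvPolynomial ℕ K) :
    evalDelta K (shiftDer K p) = graftDer {RTree.dot} (evalDelta K p) := by
  induction p using MvPolynomial.induction_on with
  | C a =>
    rw [← MvPolynomial.algebraMap_eq, Derivation.map_algebraMap, AlgHom.commutes,
      Derivation.map_algebraMap, map_zero]
  | add p q hp hq => simp only [map_add, hp, hq]
  | mul_X p n hp =>
    have hX (n : ℕ) : evalDelta K (MvPolynomial.X n) = delta K (n + 1) := by simp [evalDelta]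
    rw [Derivation.leibniz, map_mul, Derivation.leibniz, map_add, smul_eq_mul, smul_eq_mul,
      map_mul, map_mul, hp, shiftDer, MvPolynomial.mkDerivation_X, hX, hX, ← delta_add_two]
    rfl

variable (K) in
/-- The polynomial that expresses the antipode of `δ_{n+1}`. -/
def antipodePoly : ℕ → MvPolynomial ℕ K
  | 0 => - MvPolynomial.X 0
  | n + 1 => shiftDer K (antipodePoly n) -
      MvPolynomial.C ((n + 1 : ℕ) : K) * (MvPolynomial.X 0 * antipodePoly n)

theorem antipode_delta (n : ℕ) :
    HopfAlgebra.antipode K (delta K (n + 1)) = evalDelta K (antipodePoly K n) := by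
  change antipodeHom K _ = _
  induction n with
  | zero => simp [antipodePoly, evalDelta, delta_one, antipode_dot]
  | succ n ih =>
    rw [antipode_delta_succ, ih, antipodePoly, map_sub, evalDelta_shiftDer, map_mul, map_mul]
    simp [evalDelta]

/-- The derivation replaces one factor `X_k` of `X^s` by `X_{k+1}`, with multiplicity `s_k`. It
yields `X^m` exactly when `s = m - e_{k+1} + e_k`, and then `s_k = m_k + 1`. The bound `N` makes the
sum range independent of `p`. -/
theorem coeff_shiftDer (p : MvPolynomial ℕ K) (m : ℕ →₀ ℕ) (N : ℕ) (hm : ∀ j, N < j → m j = 0) :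
    (shiftDer K p).coeff m = ∑ k ∈ Finset.range N, if 1 ≤ m (k + 1) then
      (m k + 1 : K) * p.coeff (m - Finsupp.single (k + 1) 1 + Finsupp.single k 1) else 0 := by
  classical
  induction p using MvPolynomial.induction_on' with
  | add p q hp hq =>
    rw [map_add, MvPolynomial.coeff_add, hp, hq, ← Finset.sum_add_distrib]
    refine Finset.sum_congr rfl fun k _ => ?_
    split_ifs
    · rw [MvPolynomial.coeff_add, mul_add]
    · simp
  | monomial s c =>
    have key (k : ℕ) : (if s - Finsupp.single k 1 + Finsupp.single (k + 1) 1 = m then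
          c * (s k : K) else 0) =
        if 1 ≤ m (k + 1) then (m k + 1 : K) * (MvPolynomial.monomial s c).coeff
          (m - Finsupp.single (k + 1) 1 + Finsupp.single k 1) else 0 := by
      rw [MvPolynomial.coeff_monomial]
      -- If `s k = 0`, the truncated subtraction is not reversible, but the multiplicity vanishes.
      by_cases hs : s k = 0
      · rw [hs, Nat.cast_zero, mul_zero, ite_self]
        symm
        split_ifs with h1 h2
        · rw [h2] at hs; simp at hs
        · simp
        · rfl
      · by_cases h : s - Finsupp.single k 1 + Finsupp.single (k + 1) 1 = m
        · subst h
          have h2 : s = s - Finsupp.single k 1 + Finsupp.single (k + 1) 1 -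
              Finsupp.single (k + 1) 1 + Finsupp.single k 1 := by
            ext j
            simp only [Finsupp.add_apply, Finsupp.tsub_apply, Finsupp.single_apply]
            split_ifs <;> (try subst_vars) <;> omega
          have h3 : (s - Finsupp.single k 1 + Finsupp.single (k + 1) 1 : ℕ →₀ ℕ) k + 1 = s k := by
            simp only [Finsupp.add_apply, Finsupp.tsub_apply, Finsupp.single_apply]
            simp; omega
          rw [if_pos rfl, if_pos (by simp), if_pos h2, ← h3]
          push_cast; ring
        · rw [if_neg h]
          symm
          split_ifs with h1 h2
          · refine absurd ?_ h
            rw [h2]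
            ext j
            simp only [Finsupp.add_apply, Finsupp.tsub_apply, Finsupp.single_apply]
            split_ifs <;> (try subst_vars) <;> omega
          · simp
          · rfl
    rw [shiftDer, MvPolynomial.mkDerivation_monomial, Finsupp.sum, Finset.smul_sum]
    simp only [← key]
    have hco (k : ℕ) : (c • (MvPolynomial.monomial (s - Finsupp.single k 1) ((s k : ℕ) : K) •
        (MvPolynomial.X (k + 1) : MvPolynomial ℕ K))).coeff m =
        if s - Finsupp.single k 1 + Finsupp.single (k + 1) 1 = m then c * (s k : K) else 0 := by
      rw [smul_eq_mul, MvPolynomial.X, MvPolynomial.monomial_mul, MvPolynomial.smul_monomial,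
        MvPolynomial.coeff_monomial]
      simp
    rw [MvPolynomial.coeff_sum]
    simp only [hco]
    -- The sums run over the support of `s` and over `range N`; terms outside the intersection
    -- vanish, because `m (k + 1) = 0` or because `s k = 0`.
    refine Finset.sum_congr_of_eq_on_inter ?_ ?_ fun _ _ _ => rfl
    · intro k _ hk
      refine if_neg fun h => ?_
      have := hm (k + 1) (by simp at hk; omega)
      rw [← h] at this
      simp at this
    · intro k _ hk
      rw [Finsupp.notMem_support_iff.1 hk]
      simp

/-- The weight `1 m_0 + 2 m_1 + ⋯` of an exponent. -/
abbrev deltaWeight : (ℕ →₀ ℕ) →+ ℕ := Finsupp.weight fun k : ℕ => k + 1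

theorem deltaWeight_sub_single {m : ℕ →₀ ℕ} {k : ℕ} (hk : 1 ≤ m k) :
    deltaWeight (m - Finsupp.single k 1) + (k + 1) = deltaWeight m := by
  have h : m - Finsupp.single k 1 + Finsupp.single k 1 = m :=
    tsub_add_cancel_of_le (by simpa using hk)
  conv_rhs => rw [← h, map_add, Finsupp.weight_single]
  simp

theorem deltaWeight_shift {m : ℕ →₀ ℕ} {k : ℕ} (hk : 1 ≤ m (k + 1)) :
    deltaWeight (m - Finsupp.single (k + 1) 1 + Finsupp.single k 1) + 1 = deltaWeight m := by
  rw [← deltaWeight_sub_single hk, map_add, Finsupp.weight_single]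
  simp; ring

theorem eq_zero_of_deltaWeight_le {m : ℕ →₀ ℕ} {j : ℕ} (h : deltaWeight m ≤ j) : m j = 0 := by
  by_contra hj
  have := deltaWeight_sub_single (Nat.one_le_iff_ne_zero.2 hj)
  omega

theorem coeff_antipodePoly_succ (n : ℕ) (m : ℕ →₀ ℕ) (N : ℕ) (hm : ∀ j, N < j → m j = 0) :
    (antipodePoly K (n + 1)).coeff m =
      (∑ k ∈ Finset.range N, if 1 ≤ m (k + 1) then (m k + 1 : K) *
        (antipodePoly K n).coeff (m - Finsupp.single (k + 1) 1 + Finsupp.single k 1) else 0) -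
      ((n + 1 : ℕ) : K) *
        if 1 ≤ m 0 then (antipodePoly K n).coeff (m - Finsupp.single 0 1) else 0 := by
  rw [antipodePoly, MvPolynomial.coeff_sub, coeff_shiftDer _ _ N hm, MvPolynomial.coeff_C_mul,
    MvPolynomial.coeff_X_mul']
  simp [Nat.one_le_iff_ne_zero]

/-- Shifting a variable and multiplying by `X_0` both raise the weight by one. -/
theorem deltaWeight_of_coeff_antipodePoly (n : ℕ) (m : ℕ →₀ ℕ)
    (h : (antipodePoly K n).coeff m ≠ 0) : deltaWeight m = n + 1 := by
  classical
  induction n generalizing m with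
  | zero =>
    rw [antipodePoly, MvPolynomial.coeff_neg, MvPolynomial.coeff_X] at h
    by_cases hm : Finsupp.single 0 1 = m
    · rw [← hm, Finsupp.weight_single]; simp
    · simp [hm] at h
  | succ n ih =>
    contrapose! h
    -- Any bound on the support serves as `N` in the coefficient formula.
    have hm (j : ℕ) (hj : m.support.sup id < j) : m j = 0 := by
      by_contra h0
      exact absurd (Finset.le_sup (f := id) (Finsupp.mem_support_iff.2 h0)) (not_le.2 hj)
    rw [coeff_antipodePoly_succ n m _ hm, Finset.sum_eq_zero, zero_sub, neg_eq_zero]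
    · split_ifs with h0
      · rw [not_ne_iff.1 (mt (ih _) fun h1 => h ?_), mul_zero]
        rw [← deltaWeight_sub_single h0, h1]
      · simp
    · intro k _
      split_ifs with hk
      · rw [not_ne_iff.1 (mt (ih _) fun h1 => h ?_), mul_zero]
        rw [← deltaWeight_shift hk, h1]
      · rfl

/-- The variable `X_{n+1}` arises only by shifting `X_n`, with multiplicity one, so the initial sign
persists. -/
theorem coeff_single_antipodePoly (n : ℕ) :
    (antipodePoly K n).coeff (Finsupp.single n 1) = -1 := by
  classical
  induction n with
  | zero => simp [antipodePoly]
  | succ n ih =>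
    rw [coeff_antipodePoly_succ n _ (n + 1) fun j hj => Finsupp.single_eq_of_ne (by omega),
      Finset.sum_eq_single_of_mem n (by simp)]
    · simp [ih]
    · intro k _ hk
      simp [Ne.symm hk]

/-! ### Multi-indices as exponents -/

/-- A multi-index, as an exponent of the monomials in infinitely many variables. -/
def extIndex {n : ℕ} (i : Fin n → ℕ) : ℕ →₀ ℕ := ∑ k : Fin n, Finsupp.single (k : ℕ) (i k)

theorem extIndex_apply {n : ℕ} (i : Fin n → ℕ) (j : ℕ) :
    extIndex i j = if h : j < n then i ⟨j, h⟩ else 0 := by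
  classical
  rw [extIndex, Finsupp.finsetSum_apply]
  split_ifs with h
  · rw [Finset.sum_eq_single_of_mem ⟨j, h⟩ (Finset.mem_univ _)]
    · simp
    · intro k _ hk
      exact Finsupp.single_eq_of_ne fun h' => hk (Fin.ext h'.symm)
  · refine Finset.sum_eq_zero fun k _ => Finsupp.single_eq_of_ne ?_
    have := k.2
    omega

theorem extIndex_apply_fin {n : ℕ} (i : Fin n → ℕ) (k : Fin n) : extIndex i k = i k := by
  simp [extIndex_apply]

theorem extIndex_injective (n : ℕ) : Function.Injective (extIndex (n := n)) := fun i j h =>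
  funext fun k => by rw [← extIndex_apply_fin i, h, extIndex_apply_fin]

theorem deltaWeight_extIndex {n : ℕ} (i : Fin n → ℕ) :
    deltaWeight (extIndex i) = ∑ k : Fin n, ((k : ℕ) + 1) * i k := by
  simp [extIndex, Finsupp.weight_single, mul_comm]

theorem extIndex_of_deltaWeight_le {n : ℕ} {m : ℕ →₀ ℕ} (h : deltaWeight m ≤ n) :
    extIndex (fun k : Fin n => m k) = m := by
  ext j
  rw [extIndex_apply]
  split_ifs with hj
  · rfl
  · exact (eq_zero_of_deltaWeight_le (h.trans (not_lt.1 hj))).symm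

theorem mem_weightedIndices_iff_deltaWeight {n : ℕ} {i : Fin n → ℕ} :
    i ∈ weightedIndices n ↔ deltaWeight (extIndex i) = n := by
  rw [mem_weightedIndices, deltaWeight_extIndex]

/-- The polynomial with prescribed coefficients at the multi-indices of weight `n`. -/
def weightedPoly (n : ℕ) (b : (Fin n → ℕ) → K) : MvPolynomial ℕ K :=
  ∑ i ∈ weightedIndices n, MvPolynomial.monomial (extIndex i) (b i)

theorem evalDelta_weightedPoly (n : ℕ) (b : (Fin n → ℕ) → K) :
    evalDelta K (weightedPoly n b) =
      ∑ i ∈ weightedIndices n, b i • ∏ k : Fin n, delta K ((k : ℕ) + 1) ^ i k := by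
  rw [weightedPoly, map_sum]
  refine Finset.sum_congr rfl fun i _ => ?_
  rw [evalDelta, MvPolynomial.aeval_monomial, extIndex, ← Finsupp.prod_finsetSum_index
    (fun _ => pow_zero _) (fun _ _ _ => pow_add _ _ _), Algebra.smul_def]
  simp

theorem coeff_weightedPoly {n : ℕ} (b : (Fin n → ℕ) → K) {i : Fin n → ℕ}
    (hi : i ∈ weightedIndices n) : (weightedPoly n b).coeff (extIndex i) = b i := by
  classical
  rw [weightedPoly, MvPolynomial.coeff_sum, Finset.sum_eq_single_of_mem i hi]
  · simp
  · intro j _ hj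
    rw [MvPolynomial.coeff_monomial, if_neg fun h => hj (extIndex_injective n h)]

/-- An exponent of weight `n` involves only the first `n` variables, hence comes from a multi-index
of length `n`. -/
theorem weightedPoly_coeff {n : ℕ} {p : MvPolynomial ℕ K}
    (hp : ∀ m, p.coeff m ≠ 0 → deltaWeight m = n) :
    weightedPoly n (fun i => p.coeff (extIndex i)) = p := by
  classical
  ext m
  by_cases hm : deltaWeight m = n
  · have h := extIndex_of_deltaWeight_le hm.le
    rw [← h, coeff_weightedPoly]
    rw [mem_weightedIndices_iff_deltaWeight, h, hm]
  · rw [not_ne_iff.1 (mt (hp m) hm), weightedPoly, MvPolynomial.coeff_sum]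
    refine Finset.sum_eq_zero fun i hi => ?_
    rw [MvPolynomial.coeff_monomial, if_neg]
    rintro rfl
    exact hm (mem_weightedIndices_iff_deltaWeight.1 hi)

/-! ### Existence, uniqueness and recursion of the coefficients -/

/-- Algebraic independence turns the identity in the Hopf algebra into one between polynomials. -/
theorem isAntipodeExpansion_iff (a : (n : ℕ) → (Fin n → ℕ) → K) :
    IsAntipodeExpansion K a ↔ ∀ n, weightedPoly (n + 1) (a (n + 1)) = antipodePoly K n := by
  have h (n : ℕ) : HopfAlgebra.antipode K (delta K (n + 1)) =
      ∑ i ∈ weightedIndices (n + 1), a (n + 1) i •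
        ∏ k : Fin (n + 1), delta K ((k : ℕ) + 1) ^ i k ↔
      weightedPoly (n + 1) (a (n + 1)) = antipodePoly K n := by
    rw [← evalDelta_weightedPoly, antipode_delta, evalDelta_injective.eq_iff, eq_comm]
  refine ⟨fun ha n => (h n).1 (ha (n + 1) (by omega)), fun ha n hn => ?_⟩
  obtain ⟨n, rfl⟩ := Nat.exists_eq_succ_of_ne_zero (Nat.one_le_iff_ne_zero.1 hn)
  exact (h n).2 (ha n)

theorem exists_isAntipodeExpansion : ∃ a : (n : ℕ) → (Fin n → ℕ) → K, IsAntipodeExpansion K a :=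
  -- `antipodePoly K n` belongs to `δ_{n+1}`, whence `n - 1`; the value at `n = 0` is unconstrained.
  ⟨fun n i => (antipodePoly K (n - 1)).coeff (extIndex i), (isAntipodeExpansion_iff _).2 fun n =>
    weightedPoly_coeff (deltaWeight_of_coeff_antipodePoly n)⟩

theorem _root_.IsAntipodeExpansion.eq_coeff {a : (n : ℕ) → (Fin n → ℕ) → K}
    (ha : IsAntipodeExpansion K a) {n : ℕ} {i : Fin (n + 1) → ℕ}
    (hi : deltaWeight (extIndex i) = n + 1) :
    a (n + 1) i = (antipodePoly K n).coeff (extIndex i) := by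
  rw [← (isAntipodeExpansion_iff a).1 ha n,
    coeff_weightedPoly _ (mem_weightedIndices_iff_deltaWeight.2 hi)]

/-- The dropped last entry is zero, so truncation does not change the exponent. -/
theorem extIndex_shiftIndex_init {n : ℕ} {i : Fin (n + 2) → ℕ} (h0 : i (Fin.last (n + 1)) = 0)
    (k : Fin n) : extIndex (shiftIndex (Fin.init i) k.succ) =
      extIndex i - Finsupp.single ((k : ℕ) + 1) 1 + Finsupp.single (k : ℕ) 1 := by
  ext j
  simp only [Finsupp.add_apply, Finsupp.tsub_apply, extIndex_apply, shiftIndex,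
    Finsupp.single_apply, Fin.ext_iff, Fin.val_succ, Fin.init]
  have hk := k.2
  rcases lt_trichotomy j (n + 1) with hj | rfl | hj
  · have hj' : j < n + 2 := by omega
    simp only [hj, hj', dif_pos]
    change (if j = k + 1 then i ⟨j, _⟩ - 1 else if j + 1 = k + 1 then i ⟨j, _⟩ + 1 else i ⟨j, _⟩) = _
    split_ifs <;> omega
  · have : i ⟨n + 1, by omega⟩ = 0 := h0
    simp [this]
    omega
  · have hj' : ¬ j < n + 2 := by omega
    have hj'' : ¬ j < n + 1 := by omega
    simp [hj', hj'']
    omega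

theorem extIndex_decrFirst_init {n : ℕ} {i : Fin (n + 2) → ℕ} (h0 : i (Fin.last (n + 1)) = 0) :
    extIndex (decrFirst (Fin.init i)) = extIndex i - Finsupp.single 0 1 := by
  ext j
  simp only [Finsupp.tsub_apply, extIndex_apply, decrFirst, Finsupp.single_apply, Fin.init]
  rcases lt_trichotomy j (n + 1) with hj | rfl | hj
  · have hj' : j < n + 2 := by omega
    simp only [hj, hj', dif_pos]
    change (if j = 0 then i ⟨j, _⟩ - 1 else i ⟨j, _⟩) = _
    split_ifs <;> omega
  · have : i ⟨n + 1, by omega⟩ = 0 := h0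
    simp [this]
  · have hj' : ¬ j < n + 2 := by omega
    have hj'' : ¬ j < n + 1 := by omega
    simp [hj', hj'']

theorem _root_.IsAntipodeExpansion.recursion {a : (n : ℕ) → (Fin n → ℕ) → K}
    (ha : IsAntipodeExpansion K a) {n : ℕ} {i : Fin (n + 2) → ℕ}
    (hi : deltaWeight (extIndex i) = n + 2) (h0 : i (Fin.last (n + 1)) = 0) :
    a (n + 2) i =
      (∑ j ∈ Finset.univ.filter fun j : Fin (n + 1) => 1 ≤ (j : ℕ) ∧ 1 ≤ Fin.init i j,
        ((Fin.init i (predPosition j) : ℕ) + 1 : K) * a (n + 1) (shiftIndex (Fin.init i) j))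
      - ((n + 1 : ℕ) : K) * (if 1 ≤ i 0 then a (n + 1) (decrFirst (Fin.init i)) else 0) := by
  have hm (j : ℕ) (hj : n < j) : extIndex i j = 0 := by
    rw [extIndex_apply]
    split_ifs with h
    · obtain rfl : j = n + 1 := by omega
      exact h0
    · rfl
  have h00 : extIndex i 0 = i 0 := extIndex_apply_fin i 0
  rw [ha.eq_coeff hi, coeff_antipodePoly_succ n _ n hm, Finset.sum_range, Finset.sum_filter,
    Fin.sum_univ_succ, h00]
  congr 1
  -- Position `0` has no predecessor and is filtered out; the others are the `k.succ`.
  · rw [if_neg (by simp), zero_add]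
    refine Finset.sum_congr rfl fun k _ => ?_
    have h1 : extIndex i (k + 1) = Fin.init i k.succ := extIndex_apply_fin i k.succ.castSucc
    have h2 : extIndex i k = Fin.init i (predPosition k.succ) :=
      extIndex_apply_fin i k.castSucc.castSucc
    simp only [h1, h2, Fin.val_succ, Nat.le_add_left, true_and]
    split_ifs with hk
    · have hs := extIndex_shiftIndex_init h0 k
      rw [← h1] at hk
      have hw := deltaWeight_shift hk
      rw [← hs, hi] at hw
      rw [ha.eq_coeff (by omega), hs]
    · rfl
  · congr 1
    split_ifs with hk
    · have hs := extIndex_decrFirst_init h0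
      rw [← h00] at hk
      have hw := deltaWeight_sub_single hk
      rw [← hs, hi] at hw
      rw [ha.eq_coeff (by omega), hs]
    · rfl

end

end ConnesKreimer

theorem proposition2p1 (K : Type*) [Field K] [CharZero K] :
    -- `S(δ_n)` can be expanded as a polynomial in `δ_1, …, δ_n`
    (∃ a : (n : ℕ) → (Fin n → ℕ) → K, IsAntipodeExpansion K a) ∧
    -- and the coefficients satisfy the recursion; below, the length of the multi-index
    -- `i = (i_1, …, i_{n+1})` is `n + 1`, and `Fin.init i` is `(i_1, …, i_n)`
    ∀ a : (n : ℕ) → (Fin n → ℕ) → K, IsAntipodeExpansion K a →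
      ∀ (n : ℕ) (i : Fin (n + 1) → ℕ), ∑ k : Fin (n + 1), ((k : ℕ) + 1) * i k = n + 1 →
        (i (Fin.last n) = 1 →
          (∀ k : Fin (n + 1), k ≠ Fin.last n → i k = 0) ∧ a (n + 1) i = -1) ∧
        (i (Fin.last n) ≠ 1 →
          i (Fin.last n) = 0 ∧
          a (n + 1) i =
            (∑ j ∈ Finset.univ.filter fun j : Fin n => 1 ≤ (j : ℕ) ∧ 1 ≤ Fin.init i j,
              ((Fin.init i (predPosition j) : ℕ) + 1 : K) * a n (shiftIndex (Fin.init i) j))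
            - (n : K) * (if 1 ≤ i 0 then a n (decrFirst (Fin.init i)) else 0)) := by
  refine ⟨ConnesKreimer.exists_isAntipodeExpansion, fun a ha n i hi => ⟨fun h1 => ?_, fun h1 => ?_⟩⟩
  · rw [Fin.sum_univ_castSucc, h1, Fin.val_last] at hi
    have h0 (k : Fin (n + 1)) (hk : k ≠ Fin.last n) : i k = 0 := by
      obtain ⟨k, rfl⟩ := Fin.exists_castSucc_eq.2 hk
      -- The last entry alone exhausts the weight `n + 1`.
      have hs : ∑ k : Fin n, ((k.castSucc : ℕ) + 1) * i k.castSucc = 0 := by omega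
      simpa using Finset.sum_eq_zero_iff.1 hs k (Finset.mem_univ k)
    have hs : ConnesKreimer.extIndex i = Finsupp.single n 1 := by
      rw [ConnesKreimer.extIndex, Finset.sum_eq_single_of_mem (Fin.last n) (Finset.mem_univ _)
        fun k _ hk => by rw [h0 k hk, Finsupp.single_zero], h1, Fin.val_last]
    refine ⟨h0, ?_⟩
    rw [ha.eq_coeff (by rw [hs, Finsupp.weight_single]; simp), hs, ConnesKreimer.coeff_single_antipodePoly]
  · have h0 : i (Fin.last n) = 0 := by
      have h := hi
      rw [Fin.sum_univ_castSucc, Fin.val_last] at h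
      have h2 : i (Fin.last n) < 2 := by
        by_contra! h2
        have := Nat.mul_le_mul_left (n + 1) h2
        omega
      omega
    refine ⟨h0, ?_⟩
    -- For length one, the weight forces the single entry to be `1`, against `h0`.
    obtain _ | n := n
    · rw [Fin.sum_univ_castSucc, h0] at hi
      simp at hi
    · exact ha.recursion ((ConnesKreimer.deltaWeight_extIndex i).trans hi) h0
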